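/- Let $n\ge 1$, let $a_1,\dots,a_m\in\mathbb R^n$ and $b_1,\dots,b_m\in\mathbb R$, and suppose that the polytope $K=\{x\in\mathbb R^n : a_i^\top x\ge b_i \text{ for } i=1,\dots,m\}$ is bounded and has non-empty interior. For $x\in\operatorname{int}K$ let \[ H(x)=\sum_{i=1}^m \frac{a_i a_i^\top}{(a_i^\top x-b_i)^2},\qquad \|v\|_x=\sqrt{v^\top H(x)v}\quad(v\in\mathbb R^n), \] be the Hessian of the log-barrier $-\sum_{i}\log(a_i^\top x-b_i)$ and the local norm at $x$ (terms with $a_i=0$ are read as $0$). For $r>0$ let $g_x$ be the Gaussian distribution on $\mathbb R^n$ with mean $x$ and covariance matrix $\frac{r^2}{n}H(x)^{-1}$. Then for every $\varepsilon\in(0,\tfrac12]$, every $r$ with $0<r\le\frac{\varepsilon}{20}\left(\log\frac{11}{\varepsilon}\right)^{-3/2}$ and every $x\in\operatorname{int}K$, \[ \Pr_{z\sim g_x}\left[\, z\in\operatorname{int}K \ \text{ and }\ \|z-x\|_z^2-\|z-x\|_x^2\le 2\varepsilon\cdot\frac{r^2}{n}\,\right]\ \ge\ 1-\varepsilon. \]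 -/

import Mathlib

open MeasureTheory ProbabilityTheory

noncomputable section

namespace DikinWalk

/-- The set of points of `ℝⁿ` satisfying the inequalities `aᵢᵀ x ≥ bᵢ`, `i ∈ [m]`. -/
def polytope {m n : ℕ} (a : Fin m → EuclideanSpace ℝ (Fin n)) (b : Fin m → ℝ) :
    Set (EuclideanSpace ℝ (Fin n)) :=
  {x | ∀ i, b i ≤ inner ℝ (a i) x}

/-- The Hessian of the log-barrier `x ↦ -∑ᵢ log (aᵢᵀ x - bᵢ)`, namely
`H(x) = ∑ᵢ (aᵢᵀ x - bᵢ)⁻² aᵢ aᵢᵀ`. -/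
def barrierHessian {m n : ℕ} (a : Fin m → EuclideanSpace ℝ (Fin n)) (b : Fin m → ℝ)
    (x : EuclideanSpace ℝ (Fin n)) : Matrix (Fin n) (Fin n) ℝ :=
  ∑ i, (1 / (inner ℝ (a i) x - b i) ^ 2) • Matrix.vecMulVec (a i).ofLp (a i).ofLp

/-- The local norm `‖v‖ₓ = √(vᵀ H(x) v)`. -/
def localNorm {m n : ℕ} (a : Fin m → EuclideanSpace ℝ (Fin n)) (b : Fin m → ℝ)
    (x v : EuclideanSpace ℝ (Fin n)) : ℝ :=
  Real.sqrt (v.ofLp ⬝ᵥ (barrierHessian a b x).mulVec v.ofLp)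

/-- The proposal distribution `gₓ` of the Gaussian Dikin walk: the Gaussian distribution with
mean `x` and covariance matrix `(r² / n) H(x)⁻¹`. -/
def proposal {m n : ℕ} (a : Fin m → EuclideanSpace ℝ (Fin n)) (b : Fin m → ℝ) (r : ℝ)
    (x : EuclideanSpace ℝ (Fin n)) : Measure (EuclideanSpace ℝ (Fin n)) :=
  multivariateGaussian x ((r ^ 2 / (n : ℝ)) • (barrierHessian a b x)⁻¹)

end DikinWalk

end

/-! ### Gaussian moments and rotation invariance. -/

namespace DikinWalk

open scoped Nat RealInnerProductSpace

/-! Write z = x + Ag with g standard Gaussian and A the square root of the covariance. The rescaled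
vectors c_i of `whitenedSlack` form a Parseval frame (`sum_inner_whitenedSlack_sq`), and with δ =
r/√n each slack with a_i ≠ 0 is multiplied by 1 + d_i, where d_i = δ⟨c_i, g⟩. The difference of
squared norms is Σ ((d_i/(1+d_i))² - d_i²), at most -2δ³P + 4δ⁴Q once all |d_i| ≤ 1/10, with P =
Σ⟨c_i,g⟩³ and Q = Σ⟨c_i,g⟩⁴. It thus suffices that P² ≲ nL³ and Q ≲ nL³ for L = log(11/ε); the bound
on Q also makes every d_i small, which keeps z in the interior
(`mem_acceptance_of_cubic_quartic_le`).

Moments of Q come from Jensen (`lintegral_quartic_pow_le`). For P, rotating a pair of independent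
Gaussians bounds its L^{2k} norm by that of the form R(x,y) = Σ⟨c_i,x⟩²⟨c_i,y⟩ (`eLpNorm_cubic_le`).
Given x, R is a centred Gaussian of variance at most Q(x), so its moments reduce to those of Q.
Markov's inequality at order k ≈ L/2 makes each bad event have probability at most e^{1-L} ≤ ε/2. -/

lemma integral_even_pow_gaussianReal (k : ℕ) :
    ∫ x, x ^ (2 * k) ∂(gaussianReal 0 1) = ((2 * k - 1 : ℕ)‼ : ℝ) := by
  rw [integral_gaussianReal_eq_integral_smul one_ne_zero]
  have h1 : ∀ x : ℝ, gaussianPDFReal 0 1 x • x ^ (2 * k) =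
      (fun y : ℝ => (√(2 * Real.pi))⁻¹ * (y ^ (2 * k) * Real.exp (-(1 / 2) * y ^ 2))) |x| := by
    intro x
    have : |x| ^ (2 * k) = x ^ (2 * k) := by rw [pow_mul, pow_mul, sq_abs]
    simp only [gaussianPDFReal, NNReal.coe_one, mul_one, sub_zero, smul_eq_mul, sq_abs, this]
    ring_nf
  simp_rw [h1]
  rw [integral_comp_abs (f := fun y : ℝ => (√(2 * Real.pi))⁻¹ *
    (y ^ (2 * k) * Real.exp (-(1 / 2) * y ^ 2))), integral_const_mul]
  have h2 := integral_rpow_mul_exp_neg_mul_rpow (p := 2) (q := (2 * k : ℕ)) (b := 1 / 2)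
    (by norm_num) (by have := Nat.cast_nonneg (α := ℝ) (2 * k); linarith) (by norm_num)
  simp only [Real.rpow_natCast, Real.rpow_two] at h2
  rw [h2]
  have h3 : (((2 * k : ℕ) : ℝ) + 1) / 2 = k + 1 / 2 := by push_cast; ring
  rw [h3, Real.Gamma_nat_add_half, neg_div, h3, one_div, Real.inv_rpow (by norm_num),
    Real.rpow_neg (by norm_num), inv_inv, Real.rpow_add (by norm_num), Real.rpow_natCast,
    ← one_div (2 : ℝ), ← Real.sqrt_eq_rpow, Real.sqrt_mul (by norm_num)]
  have : √Real.pi ≠ 0 := by positivity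
  field_simp

lemma integrable_pow_gaussianReal (j : ℕ) :
    Integrable (fun x : ℝ => x ^ j) (gaussianReal 0 1) := by
  rcases Nat.eq_zero_or_pos j with rfl | hj
  · simp
  · have := (memLp_id_gaussianReal (μ := 0) (v := 1) j).integrable_norm_pow hj.ne'
    refine this.mono' (by fun_prop) (Filter.Eventually.of_forall fun x => ?_)
    simp

lemma lintegral_even_pow_gaussianReal (k : ℕ) :
    -- At k = 0 the truncated subtraction gives 0‼ = 1, the correct zeroth moment.
    ∫⁻ x, ENNReal.ofReal (x ^ (2 * k)) ∂(gaussianReal 0 1) = ((2 * k - 1 : ℕ)‼ : ENNReal) := by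
  rw [← ofReal_integral_eq_lintegral_ofReal (integrable_pow_gaussianReal _)
    (Filter.Eventually.of_forall fun x => (even_two_mul k).pow_nonneg x),
    integral_even_pow_gaussianReal, ENNReal.ofReal_natCast]

section Euclidean

variable {E : Type*} [NormedAddCommGroup E] [InnerProductSpace ℝ E] [FiniteDimensional ℝ E]
  [MeasurableSpace E] [BorelSpace E]

lemma stdGaussian_map_inner (v : E) :
    (stdGaussian E).map (fun x => ⟪v, x⟫) = (gaussianReal 0 1).map (fun t => ‖v‖ * t) := by
  have h := IsGaussian.map_eq_gaussianReal (μ := stdGaussian E) (innerSL ℝ v)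
  rw [variance_dual_stdGaussian, integral_strongDual_stdGaussian, innerSL_apply_norm] at h
  rw [gaussianReal_map_const_mul]
  simp only [mul_zero, mul_one]
  convert h using 2
  · ext x; simp
  · rw [← NNReal.coe_inj]; simp

lemma lintegral_inner_even_pow_stdGaussian (v : E) (k : ℕ) :
    ∫⁻ x, ENNReal.ofReal (⟪v, x⟫ ^ (2 * k)) ∂(stdGaussian E) =
      ENNReal.ofReal (‖v‖ ^ (2 * k)) * ((2 * k - 1 : ℕ)‼ : ENNReal) := by
  have h : ∫⁻ x, ENNReal.ofReal (⟪v, x⟫ ^ (2 * k)) ∂(stdGaussian E) =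
      ∫⁻ t, ENNReal.ofReal (t ^ (2 * k)) ∂((stdGaussian E).map (fun x => ⟪v, x⟫)) := by
    rw [lintegral_map (by fun_prop) (by fun_prop)]
  rw [h, stdGaussian_map_inner, lintegral_map (by fun_prop) (by fun_prop)]
  simp_rw [mul_pow]
  have h2 : ∀ t : ℝ, ENNReal.ofReal (‖v‖ ^ (2 * k) * t ^ (2 * k)) =
      ENNReal.ofReal (‖v‖ ^ (2 * k)) * ENNReal.ofReal (t ^ (2 * k)) :=
    fun t => ENNReal.ofReal_mul (by positivity)
  simp_rw [h2]
  rw [lintegral_const_mul _ (by fun_prop), lintegral_even_pow_gaussianReal]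

/-- First coordinate of the rotation of a Gaussian pair by π/4. -/
lemma measurePreserving_add_div_sqrt_two :
    MeasurePreserving (fun q : E × E => (√2 / 2 : ℝ) • (q.1 + q.2))
      ((stdGaussian E).prod (stdGaussian E)) (stdGaussian E) := by
  have h : MeasurePreserving (ContinuousLinearMap.rotation (E := E) (Real.pi / 4))
      ((stdGaussian E).prod (stdGaussian E)) ((stdGaussian E).prod (stdGaussian E)) :=
    ⟨by fun_prop, IsGaussian.map_rotation_eq_self (by simp) _⟩
  have h2 := measurePreserving_fst.comp h
  convert h2 using 1
  ext q
  simp [ContinuousLinearMap.rotation_apply, smul_add]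

end Euclidean

end DikinWalk

/-! ### Parseval frames: moments of the quartic and of the polarized cubic. -/

namespace DikinWalk

open scoped Nat RealInnerProductSpace

section Frame

variable {E : Type*} [NormedAddCommGroup E] [InnerProductSpace ℝ E] {ι : Type*} [Fintype ι]
  {c : ι → E}

lemma norm_le_one_of_parseval (hc : ∀ v, ∑ i, ⟪c i, v⟫ ^ 2 = ‖v‖ ^ 2) (i : ι) : ‖c i‖ ≤ 1 := by
  have h : ⟪c i, c i⟫ ^ 2 ≤ ∑ j, ⟪c j, c i⟫ ^ 2 :=
    Finset.single_le_sum (f := fun j => ⟪c j, c i⟫ ^ 2) (fun j _ => sq_nonneg _) (Finset.mem_univ i)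
  rw [hc, real_inner_self_eq_norm_sq] at h
  by_contra! h1
  nlinarith [sq_nonneg (‖c i‖), mul_pos (sub_pos.2 h1) (sub_pos.2 h1)]

lemma sum_norm_sq_of_parseval [FiniteDimensional ℝ E]
    (hc : ∀ v, ∑ i, ⟪c i, v⟫ ^ 2 = ‖v‖ ^ 2) :
    ∑ i, ‖c i‖ ^ 2 = Module.finrank ℝ E := by
  have h : ∀ i, ‖c i‖ ^ 2 = ∑ j, ⟪c i, stdOrthonormalBasis ℝ E j⟫ ^ 2 := fun i =>
    ((stdOrthonormalBasis ℝ E).sum_sq_inner_left (c i)).symm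
  simp_rw [h]
  rw [Finset.sum_comm]
  simp [hc]

/-- The synthesis map is adjoint to the isometry v ↦ (⟨c_i, v⟩), hence a contraction; here by
Cauchy–Schwarz against w itself. -/
lemma norm_sum_smul_sq_le_of_parseval (hc : ∀ v, ∑ i, ⟪c i, v⟫ ^ 2 = ‖v‖ ^ 2) (t : ι → ℝ) :
    ‖∑ i, t i • c i‖ ^ 2 ≤ ∑ i, t i ^ 2 := by
  set w := ∑ i, t i • c i with hw
  have h1 : ‖w‖ ^ 2 = ∑ i, t i * ⟪c i, w⟫ := by
    rw [← real_inner_self_eq_norm_sq]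
    nth_rewrite 1 [hw]
    simp [sum_inner, real_inner_smul_left]
  have h2 := Finset.sum_mul_sq_le_sq_mul_sq Finset.univ t (fun i => ⟪c i, w⟫)
  rw [← h1, hc] at h2
  by_contra! h3
  have : 0 < ‖w‖ ^ 2 := lt_of_le_of_lt (Finset.sum_nonneg fun i _ => sq_nonneg _) h3
  nlinarith

/-- Jensen for the weights ‖c_i‖²/dim E, which sum to 1 by the trace identity. Indices with c_i = 0
have weight 0, so division by zero is harmless. -/
lemma quartic_pow_le_of_parseval [FiniteDimensional ℝ E]
    (hE : 0 < Module.finrank ℝ E) (hc : ∀ v, ∑ i, ⟪c i, v⟫ ^ 2 = ‖v‖ ^ 2) (k : ℕ) (x : E) :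
    (∑ i, ⟪c i, x⟫ ^ 4) ^ k ≤ (Module.finrank ℝ E : ℝ) ^ k *
      ∑ i, ‖c i‖ ^ 2 / Module.finrank ℝ E * (⟪c i, x⟫ ^ 4 / ‖c i‖ ^ 2) ^ k := by
  have hd : (0 : ℝ) < Module.finrank ℝ E := by exact_mod_cast hE
  have h := Real.pow_arith_mean_le_arith_mean_pow Finset.univ
    (fun i => ‖c i‖ ^ 2 / Module.finrank ℝ E) (fun i => ⟪c i, x⟫ ^ 4 / ‖c i‖ ^ 2)
    (fun i _ => by positivity)
    (by rw [← Finset.sum_div, sum_norm_sq_of_parseval hc, div_self hd.ne'])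
    (fun i _ => by positivity) k
  have h2 : ∑ i, ‖c i‖ ^ 2 / Module.finrank ℝ E * (⟪c i, x⟫ ^ 4 / ‖c i‖ ^ 2) =
      (∑ i, ⟪c i, x⟫ ^ 4) / Module.finrank ℝ E := by
    rw [Finset.sum_div]
    refine Finset.sum_congr rfl fun i _ => ?_
    by_cases h0 : c i = 0
    · simp [h0]
    · have : ‖c i‖ ≠ 0 := norm_ne_zero_iff.2 h0
      field_simp
  rw [h2, div_pow, div_le_iff₀ (by positivity)] at h
  linarith

variable [FiniteDimensional ℝ E] [MeasurableSpace E] [BorelSpace E]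

/-- After Jensen, the k-th moment of ⟨c_i,x⟩⁴/‖c_i‖² is ‖c_i‖^{2k}(4k-1)‼ for c_i ≠ 0, and ‖c_i‖ ≤
1. The bound does not depend on the number of vectors. -/
lemma lintegral_quartic_pow_le (hE : 0 < Module.finrank ℝ E)
    (hc : ∀ v, ∑ i, ⟪c i, v⟫ ^ 2 = ‖v‖ ^ 2) (k : ℕ) :
    ∫⁻ x, ENNReal.ofReal ((∑ i, ⟪c i, x⟫ ^ 4) ^ k) ∂(stdGaussian E) ≤
      ENNReal.ofReal ((Module.finrank ℝ E : ℝ) ^ k) * ((4 * k - 1 : ℕ)‼ : ENNReal) := by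
  have hd : (0 : ℝ) < Module.finrank ℝ E := by exact_mod_cast hE
  set d : ℝ := (Module.finrank ℝ E : ℝ)
  have hterm : ∀ i, ∫⁻ x, ENNReal.ofReal (‖c i‖ ^ 2 / d * (⟪c i, x⟫ ^ 4 / ‖c i‖ ^ 2) ^ k)
      ∂(stdGaussian E) ≤ ENNReal.ofReal (‖c i‖ ^ 2 / d) * ((4 * k - 1 : ℕ)‼ : ENNReal) := by
    intro i
    have h1 : ∀ x, ENNReal.ofReal (‖c i‖ ^ 2 / d * (⟪c i, x⟫ ^ 4 / ‖c i‖ ^ 2) ^ k) =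
        ENNReal.ofReal (‖c i‖ ^ 2 / d * (1 / ‖c i‖ ^ 2) ^ k) *
          ENNReal.ofReal (⟪c i, x⟫ ^ (2 * (2 * k))) := by
      intro x
      rw [← ENNReal.ofReal_mul (by positivity)]
      congr 1
      rw [← mul_assoc 2 2 k, pow_mul _ (2 * 2) k, mul_assoc, ← mul_pow]
      ring_nf
    simp_rw [h1]
    rw [lintegral_const_mul _ (by fun_prop), lintegral_inner_even_pow_stdGaussian, ← mul_assoc,
      ← ENNReal.ofReal_mul (by positivity), ← mul_assoc 2 2 k, show 2 * 2 * k = 4 * k by ring]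
    gcongr
    rw [mul_assoc]
    refine mul_le_of_le_one_right (by positivity) ?_
    rw [pow_mul _ 4 k, ← mul_pow]
    refine pow_le_one₀ (by positivity) ?_
    by_cases h0 : c i = 0
    · simp [h0]
    · have h3 : 0 < ‖c i‖ := norm_pos_iff.2 h0
      have h4 := norm_le_one_of_parseval hc i
      rw [one_div_mul_eq_div, div_le_one (by positivity)]
      exact pow_le_pow_of_le_one h3.le h4 (by norm_num)
  calc ∫⁻ x, ENNReal.ofReal ((∑ i, ⟪c i, x⟫ ^ 4) ^ k) ∂(stdGaussian E)
      ≤ ∫⁻ x, ENNReal.ofReal (d ^ k) *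
          ∑ i, ENNReal.ofReal (‖c i‖ ^ 2 / d * (⟪c i, x⟫ ^ 4 / ‖c i‖ ^ 2) ^ k)
            ∂(stdGaussian E) := by
        refine lintegral_mono fun x => ?_
        rw [← ENNReal.ofReal_sum_of_nonneg (fun i _ => by positivity),
          ← ENNReal.ofReal_mul (by positivity)]
        exact ENNReal.ofReal_le_ofReal (quartic_pow_le_of_parseval hE hc k x)
    _ = ENNReal.ofReal (d ^ k) * ∑ i, ∫⁻ x,
          ENNReal.ofReal (‖c i‖ ^ 2 / d * (⟪c i, x⟫ ^ 4 / ‖c i‖ ^ 2) ^ k) ∂(stdGaussian E) := by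
        rw [lintegral_const_mul _ (by fun_prop), lintegral_finsetSum _ (by fun_prop)]
    _ ≤ ENNReal.ofReal (d ^ k) *
          ∑ i, ENNReal.ofReal (‖c i‖ ^ 2 / d) * ((4 * k - 1 : ℕ)‼ : ENNReal) := by
        gcongr with i
        exact hterm i
    _ = _ := by
        rw [← Finset.sum_mul, ← ENNReal.ofReal_sum_of_nonneg (fun i _ => by positivity),
          ← Finset.sum_div, sum_norm_sq_of_parseval hc, div_self hd.ne']
        simp

/-- For fixed x the form is linear in y, hence Gaussian, with standard deviation ‖Σ⟨c_i,x⟩² c_i‖;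
the contraction property bounds its square by the quartic. -/
lemma lintegral_polarized_cubic_pow_le (hE : 0 < Module.finrank ℝ E)
    (hc : ∀ v, ∑ i, ⟪c i, v⟫ ^ 2 = ‖v‖ ^ 2) (k : ℕ) :
    ∫⁻ q : E × E, ENNReal.ofReal ((∑ i, ⟪c i, q.1⟫ ^ 2 * ⟪c i, q.2⟫) ^ (2 * k))
        ∂((stdGaussian E).prod (stdGaussian E)) ≤
      ENNReal.ofReal ((Module.finrank ℝ E : ℝ) ^ k) * ((4 * k - 1 : ℕ)‼ : ENNReal) *
        ((2 * k - 1 : ℕ)‼ : ENNReal) := by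
  rw [lintegral_prod _ (by fun_prop)]
  calc ∫⁻ x, ∫⁻ y, ENNReal.ofReal ((∑ i, ⟪c i, x⟫ ^ 2 * ⟪c i, y⟫) ^ (2 * k))
        ∂(stdGaussian E) ∂(stdGaussian E)
      = ∫⁻ x, ENNReal.ofReal (‖∑ i, ⟪c i, x⟫ ^ 2 • c i‖ ^ (2 * k)) *
          ((2 * k - 1 : ℕ)‼ : ENNReal) ∂(stdGaussian E) := by
        refine lintegral_congr fun x => ?_
        rw [← lintegral_inner_even_pow_stdGaussian]
        simp only [sum_inner, real_inner_smul_left]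
    _ ≤ ∫⁻ x, ENNReal.ofReal ((∑ i, ⟪c i, x⟫ ^ 4) ^ k) *
          ((2 * k - 1 : ℕ)‼ : ENNReal) ∂(stdGaussian E) := by
        refine lintegral_mono fun x => ?_
        gcongr
        rw [pow_mul]
        refine pow_le_pow_left₀ (by positivity) ?_ k
        have h4 : ∀ i, ⟪c i, x⟫ ^ 4 = (⟪c i, x⟫ ^ 2) ^ 2 := fun i => by ring
        simp_rw [h4]
        exact norm_sum_smul_sq_le_of_parseval hc (fun i => ⟪c i, x⟫ ^ 2)
    _ ≤ _ := by
        rw [lintegral_mul_const _ (by fun_prop)]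
        gcongr
        exact lintegral_quartic_pow_le hE hc k

end Frame

end DikinWalk

/-! ### Decoupling the cubic form and explicit moment constants. -/

namespace DikinWalk

open scoped Nat RealInnerProductSpace

lemma eLpNorm_even_pow {α : Type*} [MeasurableSpace α] (μ : Measure α) (f : α → ℝ) {k : ℕ}
    (hk : k ≠ 0) :
    eLpNorm f (2 * k : ℕ) μ ^ (2 * k) = ∫⁻ x, ENNReal.ofReal (f x ^ (2 * k)) ∂μ := by
  have h := eLpNorm_nnreal_pow_eq_lintegral (f := f) (μ := μ) (p := ((2 * k : ℕ) : NNReal))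
    (by exact_mod_cast (by omega))
  simp only [NNReal.coe_natCast, ENNReal.rpow_natCast, ENNReal.coe_natCast] at h
  rw [h]
  refine lintegral_congr fun x => ?_
  rw [Real.enorm_eq_ofReal_abs, ← ENNReal.ofReal_pow (abs_nonneg _), (even_two_mul k).pow_abs]

variable {E : Type*} [NormedAddCommGroup E] [InnerProductSpace ℝ E] {ι : Type*} [Fintype ι]
  {c : ι → E} [FiniteDimensional ℝ E] [MeasurableSpace E] [BorelSpace E]

lemma eLpNorm_cubic_lt_top (c : ι → E) {k : ℕ} (hk : k ≠ 0) :
    eLpNorm (fun x => ∑ i, ⟪c i, x⟫ ^ 3) (2 * k : ℕ) (stdGaussian E) < ⊤ := by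
  have h : MemLp (fun x => ∑ i, ⟪c i, x⟫ ^ 3) (2 * k : ℕ) (stdGaussian E) := by
    refine memLp_finsetSum _ fun i _ => ⟨by fun_prop, ?_⟩
    refine (ENNReal.pow_lt_top_iff.1 (?_ : _ ^ (2 * k) < ⊤)).resolve_right (by omega)
    rw [eLpNorm_even_pow _ _ hk]
    have h2 : ∀ x, (⟪c i, x⟫ ^ 3) ^ (2 * k) = ⟪c i, x⟫ ^ (2 * (3 * k)) := fun x => by
      rw [← pow_mul]; congr 1; ring
    simp_rw [h2]
    rw [lintegral_inner_even_pow_stdGaussian]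
    exact ENNReal.mul_lt_top ENNReal.ofReal_lt_top (ENNReal.natCast_lt_top _)
  exact h.2

/-- Expand the cubic at (x+y)/√2, which has the law of x. The pure terms contribute 2 norms of P
against 2√2 on the left; since 2√2 > 2 they can be absorbed, leaving only the mixed terms. -/
lemma eLpNorm_cubic_le (c : ι → E) {k : ℕ} (hk : k ≠ 0) :
    ENNReal.ofReal (2 * √2 - 2) *
      eLpNorm (fun x => ∑ i, ⟪c i, x⟫ ^ 3) (2 * k : ℕ) (stdGaussian E) ≤
      6 * eLpNorm (fun q : E × E => ∑ i, ⟪c i, q.1⟫ ^ 2 * ⟪c i, q.2⟫) (2 * k : ℕ)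
        ((stdGaussian E).prod (stdGaussian E)) := by
  set p : ENNReal := ((2 * k : ℕ) : ENNReal) with hp
  have hp1 : 1 ≤ p := by rw [hp]; exact_mod_cast (by omega : 1 ≤ 2 * k)
  set μ := (stdGaussian E).prod (stdGaussian E)
  set P : E → ℝ := fun x => ∑ i, ⟪c i, x⟫ ^ 3 with hP
  set R : E × E → ℝ := fun q => ∑ i, ⟪c i, q.1⟫ ^ 2 * ⟪c i, q.2⟫ with hR
  have hPm : AEStronglyMeasurable P (stdGaussian E) := by fun_prop
  have hRm : AEStronglyMeasurable R μ := by fun_prop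
  have h1 : eLpNorm (fun q : E × E => P q.1) p μ = eLpNorm P p (stdGaussian E) :=
    eLpNorm_comp_measurePreserving hPm measurePreserving_fst
  have h2 : eLpNorm (fun q : E × E => P q.2) p μ = eLpNorm P p (stdGaussian E) :=
    eLpNorm_comp_measurePreserving hPm measurePreserving_snd
  have h3 : eLpNorm (fun q : E × E => R q.swap) p μ = eLpNorm R p μ :=
    eLpNorm_comp_measurePreserving hRm Measure.measurePreserving_swap
  have h4 : eLpNorm (fun q : E × E => P ((√2 / 2 : ℝ) • (q.1 + q.2))) p μ =
      eLpNorm P p (stdGaussian E) :=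
    eLpNorm_comp_measurePreserving hPm measurePreserving_add_div_sqrt_two
  have hs : √2 ^ 2 = (2 : ℝ) := Real.sq_sqrt (by norm_num)
  have h5 : (2 * √2) • (fun q : E × E => P ((√2 / 2 : ℝ) • (q.1 + q.2))) =
      ((fun q => P q.1) + fun q => P q.2) + (((3 : ℝ) • R) + ((3 : ℝ) • fun q => R q.swap)) := by
    ext q
    simp only [hP, hR, Pi.smul_apply, Pi.add_apply, smul_eq_mul, Finset.mul_sum,
      ← Finset.sum_add_distrib, real_inner_smul_right, inner_add_right, Prod.fst_swap,
      Prod.snd_swap]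
    refine Finset.sum_congr rfl fun i _ => ?_
    have hs4 : √2 ^ 4 = (4 : ℝ) := by rw [show (4 : ℕ) = 2 * 2 from rfl, pow_mul, hs]; norm_num
    linear_combination ((⟪c i, q.1⟫ + ⟪c i, q.2⟫) ^ 3 / 4) * hs4
  have h6 : eLpNorm ((2 * √2) • (fun q : E × E => P ((√2 / 2 : ℝ) • (q.1 + q.2)))) p μ =
      ENNReal.ofReal (2 * √2) * eLpNorm P p (stdGaussian E) := by
    rw [eLpNorm_const_smul, h4, Real.enorm_of_nonneg (by positivity)]
  have h7 : ENNReal.ofReal (2 * √2) * eLpNorm P p (stdGaussian E) ≤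
      2 * eLpNorm P p (stdGaussian E) + 6 * eLpNorm R p μ := by
    rw [← h6, h5]
    refine (eLpNorm_add_le (by fun_prop) (by fun_prop) hp1).trans ?_
    refine add_le_add ((eLpNorm_add_le (by fun_prop) (by fun_prop) hp1).trans ?_)
      ((eLpNorm_add_le (by fun_prop) (by fun_prop) hp1).trans ?_)
    · rw [h1, h2, two_mul]
    · rw [eLpNorm_const_smul, eLpNorm_const_smul, h3, Real.enorm_of_nonneg (by norm_num),
        ← add_mul]
      gcongr
      rw [← ENNReal.ofReal_add (by norm_num) (by norm_num)]
      norm_num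
  -- Finiteness is what permits the subtraction in `ENNReal`.
  have hfin : eLpNorm P p (stdGaussian E) ≠ ⊤ := (eLpNorm_cubic_lt_top c hk).ne
  rw [ENNReal.ofReal_sub _ (by norm_num), ENNReal.sub_mul fun _ _ => hfin,
    tsub_le_iff_right, add_comm]
  simpa using h7

lemma lintegral_cubic_pow_le (hE : 0 < Module.finrank ℝ E)
    (hc : ∀ v, ∑ i, ⟪c i, v⟫ ^ 2 = ‖v‖ ^ 2) {k : ℕ} (hk : k ≠ 0) :
    ∫⁻ x, ENNReal.ofReal ((∑ i, ⟪c i, x⟫ ^ 3) ^ (2 * k)) ∂(stdGaussian E) ≤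
      ENNReal.ofReal ((52.5 * Module.finrank ℝ E : ℝ) ^ k *
        ((4 * k - 1 : ℕ)‼ * (2 * k - 1 : ℕ)‼)) := by
  rw [← eLpNorm_even_pow _ _ hk]
  have h := lintegral_polarized_cubic_pow_le hE hc k
  rw [← eLpNorm_even_pow _ _ hk] at h
  have h1 := eLpNorm_cubic_le c hk
  set N := eLpNorm (fun x => ∑ i, ⟪c i, x⟫ ^ 3) (2 * k : ℕ) (stdGaussian E)
  set ρ := eLpNorm (fun q : E × E => ∑ i, ⟪c i, q.1⟫ ^ 2 * ⟪c i, q.2⟫) (2 * k : ℕ)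
        ((stdGaussian E).prod (stdGaussian E))
  have hs : (1.4142 : ℝ) ≤ √2 := Real.le_sqrt_of_sq_le (by norm_num)
  -- 52.5 rounds up (6/(2√2-2))² ≈ 52.46.
  have h2 : (√52.5 : ℝ) * (2 * √2 - 2) ≥ 6 := by
    have : (7.245 : ℝ) ≤ √52.5 := Real.le_sqrt_of_sq_le (by norm_num)
    nlinarith
  have h3 : 6 * N ≤ 6 * (ENNReal.ofReal √52.5 * ρ) := by
    calc 6 * N = ENNReal.ofReal 6 * N := by simp
      _ ≤ ENNReal.ofReal (√52.5 * (2 * √2 - 2)) * N := by gcongr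
      _ = ENNReal.ofReal √52.5 * (ENNReal.ofReal (2 * √2 - 2) * N) := by
        rw [ENNReal.ofReal_mul (by positivity), mul_assoc]
      _ ≤ ENNReal.ofReal √52.5 * (6 * ρ) := by gcongr
      _ = _ := by ring
  have h4 : N ≤ ENNReal.ofReal √52.5 * ρ :=
    (ENNReal.mul_le_mul_iff_right (by norm_num) (by norm_num)).1 h3
  calc N ^ (2 * k) ≤ (ENNReal.ofReal √52.5 * ρ) ^ (2 * k) := by gcongr
    _ = ENNReal.ofReal (52.5 ^ k) * ρ ^ (2 * k) := by
      rw [mul_pow, ← ENNReal.ofReal_pow (by positivity), pow_mul √52.5, Real.sq_sqrt (by norm_num)]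
    _ ≤ ENNReal.ofReal (52.5 ^ k) * (ENNReal.ofReal ((Module.finrank ℝ E : ℝ) ^ k) *
          ((4 * k - 1 : ℕ)‼ : ENNReal) * ((2 * k - 1 : ℕ)‼ : ENNReal)) := by gcongr
    _ = _ := by
      rw [mul_pow, ← ENNReal.ofReal_natCast, ← ENNReal.ofReal_natCast,
        ← ENNReal.ofReal_mul (by positivity), ← ENNReal.ofReal_mul (by positivity),
        ← ENNReal.ofReal_mul (by positivity)]
      congr 1
      ring

lemma one_add_mul_add_sq_le_pow {x : ℝ} (hx : 0 ≤ x) (k : ℕ) :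
    1 + k * x + k * (k - 1) / 2 * x ^ 2 ≤ (1 + x) ^ k := by
  induction k with
  | zero => simp
  | succ k ih =>
    have hk : (0 : ℝ) ≤ k * (k - 1) := by
      rcases Nat.eq_zero_or_pos k with rfl | h
      · simp
      · have : (1 : ℝ) ≤ k := by exact_mod_cast h
        exact mul_nonneg (by linarith) (by linarith)
    rw [pow_succ]
    refine le_trans ?_ (mul_le_mul_of_nonneg_right ih (by linarith))
    push_cast
    nlinarith [mul_nonneg hk (pow_nonneg hx 3)]

/-- In the induction the left side grows by about 32k³ and the right by 3(k+1)³(1+1/k)^{3k}. Plain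
Bernoulli would give only 3·2³ = 24; the second-order version gives (1+1/k)^k ≥ 9/4 for k ≥ 2, and
(9/4)³ > 11. -/
lemma doubleFactorial_mul_le {k : ℕ} (hk : 2 ≤ k) :
    ((4 * k - 1 : ℕ)‼ * (2 * k - 1 : ℕ)‼ : ℝ) ≤ (3 * (k : ℝ) ^ 3) ^ k := by
  induction k, hk using Nat.le_induction with
  | base => norm_num [Nat.doubleFactorial]
  | succ k hk ih =>
    have hk' : (2 : ℝ) ≤ k := by exact_mod_cast hk
    have e1 : (4 * (k + 1) - 1)‼ = (4 * k + 3) * ((4 * k + 1) * (4 * k - 1)‼) := by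
      obtain ⟨j, rfl⟩ : ∃ j, k = j + 1 := ⟨k - 1, by omega⟩
      rw [show 4 * (j + 1 + 1) - 1 = (4 * j + 5) + 2 by omega, Nat.doubleFactorial_add_two,
        show 4 * j + 5 = (4 * j + 3) + 2 by omega, Nat.doubleFactorial_add_two,
        show 4 * (j + 1) - 1 = 4 * j + 3 by omega]
      ring
    have e2 : (2 * (k + 1) - 1)‼ = (2 * k + 1) * (2 * k - 1)‼ := by
      obtain ⟨j, rfl⟩ : ∃ j, k = j + 1 := ⟨k - 1, by omega⟩
      rw [show 2 * (j + 1 + 1) - 1 = (2 * j + 1) + 2 by omega, Nat.doubleFactorial_add_two,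
        show 2 * (j + 1) - 1 = 2 * j + 1 by omega]
      ring
    rw [e1, e2]
    push_cast
    have hb : (9 / 4 : ℝ) ≤ (1 + 1 / (k : ℝ)) ^ k := by
      refine le_trans ?_ (one_add_mul_add_sq_le_pow (x := 1 / (k : ℝ)) (by positivity) k)
      field_simp
      nlinarith
    have hb3 : (11 : ℝ) ≤ ((1 + 1 / (k : ℝ)) ^ k) ^ 3 :=
      le_trans (by norm_num) (pow_le_pow_left₀ (by norm_num) hb 3)
    have hsplit : (3 * ((k : ℝ) + 1) ^ 3) ^ (k + 1) =
        (3 * ((k : ℝ) + 1) ^ 3) * (((1 + 1 / (k : ℝ)) ^ k) ^ 3 * (3 * (k : ℝ) ^ 3) ^ k) := by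
      rw [pow_succ' _ k, ← pow_mul, mul_comm k 3, pow_mul, ← mul_pow]
      congr 2
      field_simp
    rw [hsplit]
    calc _ = ((4 * (k : ℝ) + 3) * (4 * k + 1) * (2 * k + 1)) *
            (((4 * k - 1 : ℕ)‼ : ℝ) * (2 * k - 1 : ℕ)‼) := by ring
      _ ≤ ((3 * ((k : ℝ) + 1) ^ 3) * ((1 + 1 / (k : ℝ)) ^ k) ^ 3) * (3 * (k : ℝ) ^ 3) ^ k := by
        refine mul_le_mul ?_ ih (by positivity) (by positivity)
        calc (4 * (k : ℝ) + 3) * (4 * k + 1) * (2 * k + 1) ≤ (3 * ((k : ℝ) + 1) ^ 3) * 11 := by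
              nlinarith [pow_nonneg (by positivity : (0 : ℝ) ≤ k) 3, sq_nonneg (k : ℝ)]
          _ ≤ _ := by gcongr
      _ = _ := by ring

end DikinWalk

/-! ### Tail bounds from high moments. -/

namespace DikinWalk

open scoped Nat RealInnerProductSpace

lemma measureReal_lt_le_pow {α : Type*} [MeasurableSpace α] {μ : Measure α} [IsFiniteMeasure μ]
    {f : α → ℝ} (hf : Measurable f) {k : ℕ} {M t δ : ℝ} (hM : 0 ≤ M) (ht : 0 < t)
    (hδ : 0 ≤ δ) (hint : ∫⁻ x, ENNReal.ofReal (f x ^ k) ∂μ ≤ ENNReal.ofReal (M ^ k))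
    (hMt : M ≤ δ * t) : μ.real {x | t < f x} ≤ δ ^ k := by
  have h1 : {x | t < f x} ⊆ {x | ENNReal.ofReal (t ^ k) ≤ ENNReal.ofReal (f x ^ k)} :=
    fun x hx => ENNReal.ofReal_le_ofReal (pow_le_pow_left₀ ht.le (le_of_lt hx) k)
  have h2 : ENNReal.ofReal (t ^ k) * μ {x | t < f x} ≤ ENNReal.ofReal (t ^ k * δ ^ k) := by
    calc _ ≤ ENNReal.ofReal (t ^ k) * μ {x | ENNReal.ofReal (t ^ k) ≤ ENNReal.ofReal (f x ^ k)} := by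
          gcongr
      _ ≤ ∫⁻ x, ENNReal.ofReal (f x ^ k) ∂μ := mul_meas_ge_le_lintegral (by fun_prop) _
      _ ≤ ENNReal.ofReal (M ^ k) := hint
      _ ≤ _ := by
          refine ENNReal.ofReal_le_ofReal ?_
          rw [← mul_pow, mul_comm t δ]
          exact pow_le_pow_left₀ hM hMt k
  have h3 := ENNReal.toReal_mono ENNReal.ofReal_ne_top h2
  rw [ENNReal.toReal_mul, ENNReal.toReal_ofReal (by positivity),
    ENNReal.toReal_ofReal (by positivity)] at h3
  exact le_of_mul_le_mul_left h3 (by positivity)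

/-- Both k ≥ 2 and (L+1)/2 ≤ 2L/3 are equivalent to or follow from L ≥ 3. -/
lemma exists_moment_order {L : ℝ} (hL : 3 ≤ L) :
    ∃ k : ℕ, 2 ≤ k ∧ L - 1 ≤ 2 * k ∧ (k : ℝ) ≤ 2 / 3 * L := by
  refine ⟨⌊(L + 1) / 2⌋₊, Nat.le_floor (by push_cast; linarith), ?_, ?_⟩
  · linarith [Nat.lt_floor_add_one ((L + 1) / 2)]
  · linarith [Nat.floor_le (by linarith : 0 ≤ (L + 1) / 2)]

lemma lt_exp_neg_two : (0.135 : ℝ) < Real.exp (-2) := by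
  rw [Real.exp_neg, lt_inv_comm₀ (by norm_num) (Real.exp_pos _), ← Nat.cast_ofNat (R := ℝ),
    ← mul_one ((2 : ℕ) : ℝ), Real.exp_nat_mul]
  have h := Real.exp_one_lt_d9
  calc Real.exp 1 ^ 2 < 2.7182818286 ^ 2 := by gcongr
    _ < _ := by norm_num

lemma exp_neg_two_pow_le {L : ℝ} {k : ℕ} (h : L - 1 ≤ 2 * k) :
    Real.exp (-2) ^ k ≤ Real.exp (1 - L) := by
  rw [← Real.exp_nat_mul]
  exact Real.exp_le_exp.2 (by linarith)

variable {E : Type*} [NormedAddCommGroup E] [InnerProductSpace ℝ E] {ι : Type*} [Fintype ι]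
  {c : ι → E} [FiniteDimensional ℝ E] [MeasurableSpace E] [BorelSpace E]

lemma measureReal_cubic_gt_le (hE : 0 < Module.finrank ℝ E)
    (hc : ∀ v, ∑ i, ⟪c i, v⟫ ^ 2 = ‖v‖ ^ 2) {L : ℝ} (hL : 3 ≤ L) :
    (stdGaussian E).real {x | 361 * Module.finrank ℝ E * L ^ 3 < (∑ i, ⟪c i, x⟫ ^ 3) ^ 2} ≤
      Real.exp (1 - L) := by
  have hd : (0 : ℝ) < Module.finrank ℝ E := by exact_mod_cast hE
  obtain ⟨k, hk2, hkL, hLk⟩ := exists_moment_order hL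
  refine le_trans ?_ (exp_neg_two_pow_le hkL)
  have hk3 : (k : ℝ) ^ 3 ≤ (2 / 3 * L) ^ 3 := pow_le_pow_left₀ (by positivity) hLk 3
  -- 157.5 = 52.5 · 3, and 361 = 19² is large enough that M ≤ e⁻² times the threshold.
  refine measureReal_lt_le_pow (M := 157.5 * Module.finrank ℝ E * (k : ℝ) ^ 3) (by fun_prop)
    (by positivity) (by positivity) (Real.exp_pos _).le ?_ ?_
  · simp_rw [← pow_mul]
    refine (lintegral_cubic_pow_le hE hc (by omega)).trans (ENNReal.ofReal_le_ofReal ?_)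
    calc _ ≤ (52.5 * (Module.finrank ℝ E : ℝ)) ^ k * (3 * (k : ℝ) ^ 3) ^ k := by
          gcongr
          exact doubleFactorial_mul_le hk2
      _ = _ := by rw [← mul_pow]; ring
  · calc 157.5 * (Module.finrank ℝ E : ℝ) * (k : ℝ) ^ 3
        ≤ 157.5 * Module.finrank ℝ E * (2 / 3 * L) ^ 3 := by gcongr
      _ = (157.5 * (8 / 27)) * (Module.finrank ℝ E * L ^ 3) := by ring
      _ ≤ (0.135 * 361) * (Module.finrank ℝ E * L ^ 3) :=
          mul_le_mul_of_nonneg_right (by norm_num) (by positivity)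
      _ ≤ (Real.exp (-2) * 361) * (Module.finrank ℝ E * L ^ 3) := by
          gcongr
          exact lt_exp_neg_two.le
      _ = _ := by ring

lemma measureReal_quartic_gt_le (hE : 0 < Module.finrank ℝ E)
    (hc : ∀ v, ∑ i, ⟪c i, v⟫ ^ 2 = ‖v‖ ^ 2) {L : ℝ} (hL : 3 ≤ L) :
    (stdGaussian E).real {x | 8 * Module.finrank ℝ E * L ^ 3 < ∑ i, ⟪c i, x⟫ ^ 4} ≤
      Real.exp (1 - L) := by
  have hd : (0 : ℝ) < Module.finrank ℝ E := by exact_mod_cast hE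
  obtain ⟨k, hk2, hkL, hLk⟩ := exists_moment_order hL
  refine le_trans ?_ (exp_neg_two_pow_le hkL)
  have hk3 : (k : ℝ) ^ 3 ≤ (2 / 3 * L) ^ 3 := pow_le_pow_left₀ (by positivity) hLk 3
  refine measureReal_lt_le_pow (M := 3 * Module.finrank ℝ E * (k : ℝ) ^ 3) (by fun_prop)
    (by positivity) (by positivity) (Real.exp_pos _).le ?_ ?_
  · refine (lintegral_quartic_pow_le hE hc k).trans ?_
    rw [← ENNReal.ofReal_natCast, ← ENNReal.ofReal_mul (by positivity)]
    refine ENNReal.ofReal_le_ofReal ?_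
    -- The spare factor (2k-1)‼ is inserted to reuse the estimate made for the cubic; the loss is
    -- harmless since L³ is the scale used there too.
    have h1 : (1 : ℝ) ≤ (2 * k - 1 : ℕ)‼ := by exact_mod_cast Nat.doubleFactorial_pos _
    calc _ ≤ (Module.finrank ℝ E : ℝ) ^ k * ((4 * k - 1 : ℕ)‼ * (2 * k - 1 : ℕ)‼) := by
          gcongr
          exact le_mul_of_one_le_right (by positivity) h1
      _ ≤ (Module.finrank ℝ E : ℝ) ^ k * (3 * (k : ℝ) ^ 3) ^ k := by
          gcongr
          exact doubleFactorial_mul_le hk2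
      _ = _ := by rw [← mul_pow]; ring
  · calc 3 * (Module.finrank ℝ E : ℝ) * (k : ℝ) ^ 3
        ≤ 3 * Module.finrank ℝ E * (2 / 3 * L) ^ 3 := by gcongr
      _ = (3 * (8 / 27)) * (Module.finrank ℝ E * L ^ 3) := by ring
      _ ≤ (0.135 * 8) * (Module.finrank ℝ E * L ^ 3) :=
          mul_le_mul_of_nonneg_right (by norm_num) (by positivity)
      _ ≤ (Real.exp (-2) * 8) * (Module.finrank ℝ E * L ^ 3) := by
          gcongr
          exact lt_exp_neg_two.le
      _ = _ := by ring

end DikinWalk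

/-! ### Geometry of the barrier and whitening of the proposal. -/

namespace DikinWalk

open scoped RealInnerProductSpace Matrix MatrixOrder

variable {m n : ℕ} {a : Fin m → EuclideanSpace ℝ (Fin n)} {b : Fin m → ℝ}
  {x : EuclideanSpace ℝ (Fin n)}

lemma dotProduct_barrierHessian_mulVec (a : Fin m → EuclideanSpace ℝ (Fin n)) (b : Fin m → ℝ)
    (y v : EuclideanSpace ℝ (Fin n)) :
    v.ofLp ⬝ᵥ (barrierHessian a b y).mulVec v.ofLp =
      ∑ i, (⟪a i, v⟫ / (⟪a i, y⟫ - b i)) ^ 2 := by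
  rw [barrierHessian, Matrix.sum_mulVec, dotProduct_sum]
  refine Finset.sum_congr rfl fun i _ => ?_
  have h : ⟪a i, v⟫ = v.ofLp ⬝ᵥ (a i).ofLp := by
    simp [EuclideanSpace.inner_eq_star_dotProduct]
  rw [Matrix.smul_mulVec, Matrix.vecMulVec_mulVec, h]
  simp only [dotProduct_smul, smul_eq_mul, MulOpposite.smul_eq_mul_unop, MulOpposite.unop_op,
    dotProduct_comm (a i).ofLp v.ofLp]
  rw [div_pow]
  ring

lemma localNorm_sq (a : Fin m → EuclideanSpace ℝ (Fin n)) (b : Fin m → ℝ)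
    (y v : EuclideanSpace ℝ (Fin n)) :
    localNorm a b y v ^ 2 = ∑ i, (⟪a i, v⟫ / (⟪a i, y⟫ - b i)) ^ 2 := by
  rw [localNorm, dotProduct_barrierHessian_mulVec,
    Real.sq_sqrt (Finset.sum_nonneg fun i _ => sq_nonneg _)]

/-- A small move along -a_i stays in the polytope and strictly lowers the slack. -/
lemma slack_pos_of_mem_interior (hx : x ∈ interior (polytope a b)) {i : Fin m} (hi : a i ≠ 0) :
    0 < ⟪a i, x⟫ - b i := by
  obtain ⟨ρ, hρ, hball⟩ := Metric.mem_nhds_iff.1 (mem_interior_iff_mem_nhds.1 hx)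
  have hn : 0 < ‖a i‖ := norm_pos_iff.2 hi
  have hmem : x - (ρ / 2 / ‖a i‖) • a i ∈ Metric.ball x ρ := by
    rw [mem_ball_iff_norm, sub_sub_cancel_left, norm_neg, norm_smul, Real.norm_of_nonneg
      (by positivity), div_mul_cancel₀ _ hn.ne']
    linarith
  have h := hball hmem i
  rw [inner_sub_right, real_inner_smul_right, real_inner_self_eq_norm_sq] at h
  have : 0 < ρ / 2 / ‖a i‖ * ‖a i‖ ^ 2 := by positivity
  linarith

lemma mem_interior_of_slack_pos (hx : x ∈ polytope a b) {z : EuclideanSpace ℝ (Fin n)}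
    (hz : ∀ i, a i ≠ 0 → 0 < ⟪a i, z⟫ - b i) : z ∈ interior (polytope a b) := by
  refine mem_interior.2 ⟨{y | ∀ i, a i ≠ 0 → b i < ⟪a i, y⟫}, ?_, ?_, fun i hi => ?_⟩
  · intro y hy i
    by_cases hi : a i = 0
    · have := hx i
      rw [hi, inner_zero_left] at this ⊢
      exact this
    · exact (hy i hi).le
  · simp only [Set.ofPred_forall]
    exact isOpen_iInter_of_finite fun i => isOpen_iInter_of_finite fun _ =>
      isOpen_lt continuous_const (by fun_prop)
  · linarith [hz i hi]

lemma eq_zero_of_forall_inner_eq_zero (hK : Bornology.IsBounded (polytope a b))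
    (hx : x ∈ polytope a b) {v : EuclideanSpace ℝ (Fin n)} (hv : ∀ i, ⟪a i, v⟫ = 0) : v = 0 := by
  obtain ⟨C, hC⟩ := hK.exists_norm_le
  by_contra h0
  have hn : 0 < ‖v‖ := norm_pos_iff.2 h0
  have hmem : ∀ t : ℝ, x + t • v ∈ polytope a b := fun t i => by
    rw [inner_add_right, real_inner_smul_right, hv i, mul_zero, add_zero]
    exact hx i
  have hxC := hC x hx
  have hC0 : 0 ≤ C := (norm_nonneg x).trans hxC
  have h1 := hC _ (hmem ((2 * C + 1) / ‖v‖))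
  have h2 : ‖((2 * C + 1) / ‖v‖) • v‖ = 2 * C + 1 := by
    rw [norm_smul, Real.norm_of_nonneg (by positivity), div_mul_cancel₀ _ hn.ne']
  have h3 := norm_sub_le (x + ((2 * C + 1) / ‖v‖) • v) x
  rw [add_sub_cancel_left, h2] at h3
  linarith

lemma posDef_barrierHessian (hK : Bornology.IsBounded (polytope a b))
    (hx : x ∈ interior (polytope a b)) : (barrierHessian a b x).PosDef := by
  rw [Matrix.posDef_iff_dotProduct_mulVec]
  refine ⟨?_, fun v hv => ?_⟩
  · rw [Matrix.IsHermitian, Matrix.conjTranspose_eq_transpose_of_trivial, barrierHessian,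
      Matrix.transpose_sum]
    refine Finset.sum_congr rfl fun i _ => ?_
    rw [Matrix.transpose_smul, Matrix.transpose_vecMulVec]
  · have h := dotProduct_barrierHessian_mulVec a b x (WithLp.toLp 2 v)
    simp only [star_trivial] at h ⊢
    rw [h]
    refine lt_of_le_of_ne (Finset.sum_nonneg fun i _ => sq_nonneg _) fun h0 => hv ?_
    have h1 := (Finset.sum_eq_zero_iff_of_nonneg fun i _ => sq_nonneg _).1 h0.symm
    have h2 := eq_zero_of_forall_inner_eq_zero hK (interior_subset hx) (v := WithLp.toLp 2 v)
      fun i => by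
        by_cases hi : a i = 0
        · simp [hi]
        · have h3 := pow_eq_zero_iff (two_ne_zero) |>.1 (h1 i (Finset.mem_univ i))
          exact (div_eq_zero_iff.1 h3).resolve_right (slack_pos_of_mem_interior hx hi).ne'
    simpa using h2

/-- The square root of the covariance matrix of the proposal distribution, as an operator. -/
noncomputable def covSqrt (a : Fin m → EuclideanSpace ℝ (Fin n)) (b : Fin m → ℝ) (r : ℝ)
    (x : EuclideanSpace ℝ (Fin n)) : EuclideanSpace ℝ (Fin n) →L[ℝ] EuclideanSpace ℝ (Fin n) :=
  Matrix.toEuclideanCLM (𝕜 := ℝ)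
    (CFC.sqrt ((r ^ 2 / (n : ℝ)) • (barrierHessian a b x)⁻¹))

lemma proposal_eq_map (a : Fin m → EuclideanSpace ℝ (Fin n)) (b : Fin m → ℝ) (r : ℝ)
    (x : EuclideanSpace ℝ (Fin n)) :
    proposal a b r x =
      (stdGaussian (EuclideanSpace ℝ (Fin n))).map (fun g => x + covSqrt a b r x g) :=
  rfl

/-- The slack directions `√n / r · A aᵢ / (aᵢᵀ x - bᵢ)`, where `A` is the square root of the
covariance matrix of the proposal distribution. -/
noncomputable def whitenedSlack (a : Fin m → EuclideanSpace ℝ (Fin n)) (b : Fin m → ℝ) (r : ℝ)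
    (x : EuclideanSpace ℝ (Fin n)) (i : Fin m) : EuclideanSpace ℝ (Fin n) :=
  (√n / r / (⟪a i, x⟫ - b i)) • covSqrt a b r x (a i)

lemma inner_whitenedSlack (r : ℝ) (i : Fin m) (v : EuclideanSpace ℝ (Fin n)) :
    ⟪whitenedSlack a b r x i, v⟫ = √n / r * (⟪a i, covSqrt a b r x v⟫ / (⟪a i, x⟫ - b i)) := by
  have hA : IsSelfAdjoint (covSqrt a b r x) :=
    (CFC.sqrt_nonneg _).isSelfAdjoint.map _
  rw [whitenedSlack, real_inner_smul_left, ← ContinuousLinearMap.adjoint_inner_left, hA.adjoint_eq]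
  ring

/-- From A² = (r²/n)H⁻¹ one gets (n/r²)·AHA = 1: a right inverse of the square matrix A is also a
left inverse. -/
lemma sum_inner_whitenedSlack_sq (hn : 1 ≤ n) (hK : Bornology.IsBounded (polytope a b))
    (hx : x ∈ interior (polytope a b)) {r : ℝ} (hr : 0 < r) (v : EuclideanSpace ℝ (Fin n)) :
    ∑ i, ⟪whitenedSlack a b r x i, v⟫ ^ 2 = ‖v‖ ^ 2 := by
  have hn0 : (0 : ℝ) < n := by exact_mod_cast hn
  have hH := posDef_barrierHessian hK hx
  simp_rw [inner_whitenedSlack, mul_pow]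
  rw [← Finset.mul_sum, ← dotProduct_barrierHessian_mulVec, covSqrt, Matrix.ofLp_toEuclideanCLM]
  set H := barrierHessian a b x
  set S := (r ^ 2 / (n : ℝ)) • H⁻¹ with hS
  have hSpos : S.PosSemidef := hH.inv.posSemidef.smul (by positivity)
  have hAA : CFC.sqrt S * CFC.sqrt S = S := CFC.sqrt_mul_sqrt_self _ hSpos.nonneg
  have hAt : (CFC.sqrt S)ᵀ = CFC.sqrt S := by
    have := (CFC.sqrt_nonneg S).isSelfAdjoint
    rwa [IsSelfAdjoint, Matrix.star_eq_conjTranspose,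
      Matrix.conjTranspose_eq_transpose_of_trivial] at this
  set A := CFC.sqrt S
  have hHu : IsUnit H.det := (Matrix.isUnit_iff_isUnit_det H).1 hH.isUnit
  have h1 : A * ((n / r ^ 2 : ℝ) • (A * H)) = 1 := by
    rw [Matrix.mul_smul, ← mul_assoc, hAA, hS, Matrix.smul_mul, Matrix.nonsing_inv_mul _ hHu,
      smul_smul, show (n / r ^ 2 : ℝ) * (r ^ 2 / n) = 1 by field_simp, one_smul]
  have h2 : (n / r ^ 2 : ℝ) • (A * H * A) = 1 := by
    rw [← Matrix.smul_mul]
    exact mul_eq_one_comm.1 h1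
  have h3 : (√n / r) ^ 2 = (n / r ^ 2 : ℝ) := by rw [div_pow, Real.sq_sqrt hn0.le]
  have h4 : A *ᵥ v.ofLp ⬝ᵥ H *ᵥ A *ᵥ v.ofLp = v.ofLp ⬝ᵥ (A * H * A) *ᵥ v.ofLp := by
    rw [← Matrix.mulVec_mulVec, ← Matrix.mulVec_mulVec, Matrix.dotProduct_mulVec v.ofLp A,
      ← Matrix.mulVec_transpose, hAt]
  rw [h3, h4, ← smul_eq_mul, ← dotProduct_smul, ← Matrix.smul_mulVec, h2, Matrix.one_mulVec,
    EuclideanSpace.real_norm_sq_eq]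
  simp [dotProduct, sq]

end DikinWalk

/-! ### Deterministic acceptance criterion. -/

namespace DikinWalk

open scoped RealInnerProductSpace

lemma div_one_add_sq_sub_sq_le {d : ℝ} (hd : |d| ≤ 1 / 10) :
    (d / (1 + d)) ^ 2 - d ^ 2 ≤ -2 * d ^ 3 + 4 * d ^ 4 := by
  obtain ⟨h1, h2⟩ := abs_le.1 hd
  have h3 : 0 < 1 + d := by linarith
  rw [div_pow, sub_le_iff_le_add, div_le_iff₀ (by positivity)]
  -- This is exactly the gap left after multiplying through by (1+d)².
  have h4 : 0 ≤ d ^ 4 * (1 + 6 * d + 4 * d ^ 2) :=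
    mul_nonneg (by positivity) (by nlinarith [sq_nonneg d])
  nlinarith

lemma abs_mul_le_of_sum_pow_four_le {ι : Type*} [Fintype ι] (e : ι → ℝ) {δ : ℝ}
    (h : δ ^ 4 * ∑ i, e i ^ 4 ≤ (1 / 10) ^ 4) (i : ι) : |δ * e i| ≤ 1 / 10 := by
  have h1 : e i ^ 4 ≤ ∑ j, e j ^ 4 :=
    Finset.single_le_sum (f := fun j => e j ^ 4) (fun j _ => by positivity) (Finset.mem_univ i)
  refine le_of_pow_le_pow_left₀ (n := 4) (by norm_num) (by norm_num) ?_
  rw [Even.pow_abs (by decide), mul_pow]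
  exact (mul_le_mul_of_nonneg_left h1 (by positivity)).trans h

lemma sum_div_one_add_sq_sub_sq_le {ι : Type*} [Fintype ι] (e : ι → ℝ) {δ ε : ℝ}
    (hd : ∀ i, |δ * e i| ≤ 1 / 10) (hP : |δ * ∑ i, e i ^ 3| ≤ 19 / 20 * ε)
    (hQ : δ ^ 2 * ∑ i, e i ^ 4 ≤ ε / 50) :
    ∑ i, (δ * e i / (1 + δ * e i)) ^ 2 - ∑ i, (δ * e i) ^ 2 ≤ 2 * ε * δ ^ 2 := by
  rw [← Finset.sum_sub_distrib]
  calc _ ≤ ∑ i, (-2 * (δ * e i) ^ 3 + 4 * (δ * e i) ^ 4) :=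
        Finset.sum_le_sum fun i _ => div_one_add_sq_sub_sq_le (hd i)
    _ = δ ^ 2 * (-2 * (δ * ∑ i, e i ^ 3) + 4 * (δ ^ 2 * ∑ i, e i ^ 4)) := by
        simp only [Finset.mul_sum, ← Finset.sum_add_distrib]
        refine Finset.sum_congr rfl fun i _ => by ring
    _ ≤ δ ^ 2 * (2 * ε) := by
        gcongr
        -- The budget: 2·(19/20) + 4/50 = 1.98 < 2.
        linarith [neg_le_of_abs_le hP, abs_nonneg (δ * ∑ i, e i ^ 3)]
    _ = _ := by ring

variable {m n : ℕ} {a : Fin m → EuclideanSpace ℝ (Fin n)} {b : Fin m → ℝ}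
  {x : EuclideanSpace ℝ (Fin n)}

lemma mem_acceptance_of_cubic_quartic_le (hn : 1 ≤ n) (hx : x ∈ interior (polytope a b))
    {ε : ℝ} (hε : 0 < ε) (hε' : ε ≤ 1 / 2) {r : ℝ} (hr : 0 < r) {L : ℝ} (hL : 3 ≤ L)
    (hrL : r ^ 2 * L ^ 3 ≤ ε ^ 2 / 400) {g : EuclideanSpace ℝ (Fin n)}
    (hP : (∑ i, ⟪whitenedSlack a b r x i, g⟫ ^ 3) ^ 2 ≤ 361 * n * L ^ 3)
    (hQ : ∑ i, ⟪whitenedSlack a b r x i, g⟫ ^ 4 ≤ 8 * n * L ^ 3) :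
    x + covSqrt a b r x g ∈
      {z | z ∈ interior (polytope a b) ∧
        localNorm a b z (z - x) ^ 2 - localNorm a b x (z - x) ^ 2 ≤
          2 * ε * (r ^ 2 / (n : ℝ))} := by
  have hn1 : (1 : ℝ) ≤ n := by exact_mod_cast hn
  have hn0 : (0 : ℝ) < n := by linarith
  set δ := r / √n with hδ
  have hδ2 : δ ^ 2 = r ^ 2 / n := by rw [hδ, div_pow, Real.sq_sqrt hn0.le]
  have hslack : ∀ i, ⟪a i, covSqrt a b r x g⟫ / (⟪a i, x⟫ - b i) =
      δ * ⟪whitenedSlack a b r x i, g⟫ := by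
    intro i
    have : √(n : ℝ) ≠ 0 := by positivity
    rw [inner_whitenedSlack, hδ]
    field_simp
  set w := covSqrt a b r x g
  set e : Fin m → ℝ := fun i => ⟪whitenedSlack a b r x i, g⟫
  have hQ2 : δ ^ 2 * ∑ i, e i ^ 4 ≤ ε / 50 := by
    calc δ ^ 2 * ∑ i, e i ^ 4 ≤ r ^ 2 / n * (8 * n * L ^ 3) := by rw [hδ2]; gcongr
      _ = 8 * (r ^ 2 * L ^ 3) := by field_simp
      _ ≤ ε / 50 := by nlinarith
  have hP2 : |δ * ∑ i, e i ^ 3| ≤ 19 / 20 * ε := by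
    refine abs_le_of_sq_le_sq ?_ (by positivity)
    calc (δ * ∑ i, e i ^ 3) ^ 2 = r ^ 2 / n * (∑ i, e i ^ 3) ^ 2 := by rw [mul_pow, hδ2]
      _ ≤ r ^ 2 / n * (361 * n * L ^ 3) := by gcongr
      _ = 361 * (r ^ 2 * L ^ 3) := by field_simp
      _ ≤ (19 / 20 * ε) ^ 2 := by nlinarith
  have hδ3 : δ ^ 2 ≤ 1 / 400 := by
    have h1 : r ^ 2 * 1 ≤ r ^ 2 * L ^ 3 := by gcongr; exact one_le_pow₀ (by linarith)
    have h2 : r ^ 2 ≤ 1 / 400 := by nlinarith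
    rw [hδ2]
    exact (div_le_self (by positivity) hn1).trans h2
  -- The quartic sum dominates each single term, so no separate maximal inequality is needed.
  have hd : ∀ i, |δ * e i| ≤ 1 / 10 := by
    refine abs_mul_le_of_sum_pow_four_le e ?_
    calc δ ^ 4 * ∑ i, e i ^ 4 = δ ^ 2 * (δ ^ 2 * ∑ i, e i ^ 4) := by ring
      _ ≤ 1 / 400 * (1 / 100) := by
          gcongr
          linarith
      _ ≤ _ := by norm_num
  have hnew : ∀ i, a i ≠ 0 → ⟪a i, x + w⟫ - b i = (⟪a i, x⟫ - b i) * (1 + δ * e i) := by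
    intro i hi
    have hs := slack_pos_of_mem_interior hx hi
    rw [← hslack i, inner_add_right]
    field_simp
    ring
  have hpos : ∀ i, 0 < 1 + δ * e i := fun i => by linarith [neg_le_of_abs_le (hd i)]
  refine ⟨mem_interior_of_slack_pos (interior_subset hx) fun i hi => ?_, ?_⟩
  · rw [hnew i hi]
    exact mul_pos (slack_pos_of_mem_interior hx hi) (hpos i)
  · have hz : ∀ i, ⟪a i, w⟫ / (⟪a i, x + w⟫ - b i) = δ * e i / (1 + δ * e i) := by
      intro i
      by_cases hi : a i = 0
      · rw [← hslack i, hi]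
        -- The slack may vanish when a_i = 0, but the numerator is zero, so both quotients are 0.
        simp
      · rw [hnew i hi, ← hslack i, div_div]
    rw [add_sub_cancel_left, localNorm_sq, localNorm_sq, ← hδ2]
    simp_rw [hz, hslack]
    exact sum_div_one_add_sq_sub_sq_le e hd hP2 hQ2

end DikinWalk

/-! ### Union bound over the two bad events. -/

theorem mainTheorem4 {m n : ℕ} (hn : 1 ≤ n)
    (a : Fin m → EuclideanSpace ℝ (Fin n)) (b : Fin m → ℝ)
    (hK : Bornology.IsBounded (DikinWalk.polytope a b))
    (x : EuclideanSpace ℝ (Fin n)) (hx : x ∈ interior (DikinWalk.polytope a b))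
    (ε : ℝ) (hε : 0 < ε) (hε' : ε ≤ 1 / 2)
    (r : ℝ) (hr : 0 < r) (hr' : r ≤ ε / 20 * Real.log (11 / ε) ^ (-(3 / 2) : ℝ)) :
    1 - ε ≤ (DikinWalk.proposal a b r x).real
      {z | z ∈ interior (DikinWalk.polytope a b) ∧
        DikinWalk.localNorm a b z (z - x) ^ 2 - DikinWalk.localNorm a b x (z - x) ^ 2
          ≤ 2 * ε * (r ^ 2 / (n : ℝ))} := by
  set L := Real.log (11 / ε) with hLdef
  have hexp1 := Real.exp_one_lt_d9
  -- The 11 serves twice: 11/ε ≥ 22 > e³ here, and 2e/11 ≤ 1 in `hexp`.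
  have hL : 3 ≤ L := by
    rw [hLdef, Real.le_log_iff_exp_le (by positivity)]
    calc Real.exp 3 = Real.exp 1 ^ 3 := by rw [← Real.exp_nat_mul]; norm_num
      _ ≤ 2.7182818286 ^ 3 := by gcongr
      _ ≤ 22 := by norm_num
      _ ≤ 11 / ε := by rw [le_div_iff₀ hε]; linarith
  have hL0 : 0 < L := by linarith
  have hrL : r ^ 2 * L ^ 3 ≤ ε ^ 2 / 400 := by
    have h1 : r ^ 2 ≤ (ε / 20 * L ^ (-(3 / 2) : ℝ)) ^ 2 := by gcongr
    have h2 : (L ^ (-(3 / 2) : ℝ)) ^ 2 * L ^ 3 = 1 := by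
      rw [← Real.rpow_natCast, ← Real.rpow_natCast, ← Real.rpow_mul hL0.le, ← Real.rpow_add hL0]
      norm_num
    calc r ^ 2 * L ^ 3 ≤ (ε / 20 * L ^ (-(3 / 2) : ℝ)) ^ 2 * L ^ 3 := by gcongr
      _ = (ε / 20) ^ 2 * ((L ^ (-(3 / 2) : ℝ)) ^ 2 * L ^ 3) := by ring
      _ = ε ^ 2 / 400 := by rw [h2]; ring
  have hexp : 2 * Real.exp (1 - L) ≤ ε := by
    rw [Real.exp_sub, hLdef, Real.exp_log (by positivity), div_div_eq_mul_div]
    rw [mul_div_assoc', div_le_iff₀ (by norm_num)]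
    nlinarith
  set γ := stdGaussian (EuclideanSpace ℝ (Fin n))
  set c := DikinWalk.whitenedSlack a b r x
  have hc : ∀ v, ∑ i, inner ℝ (c i) v ^ 2 = ‖v‖ ^ 2 :=
    DikinWalk.sum_inner_whitenedSlack_sq hn hK hx hr
  have hfin : Module.finrank ℝ (EuclideanSpace ℝ (Fin n)) = n := finrank_euclideanSpace_fin
  have hcubic := DikinWalk.measureReal_cubic_gt_le (by rw [hfin]; exact hn) hc hL
  have hquartic := DikinWalk.measureReal_quartic_gt_le (by rw [hfin]; exact hn) hc hL
  rw [hfin] at hcubic hquartic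
  set f : EuclideanSpace ℝ (Fin n) → EuclideanSpace ℝ (Fin n) := fun g =>
    x + DikinWalk.covSqrt a b r x g
  set G := {z | z ∈ interior (DikinWalk.polytope a b) ∧
        DikinWalk.localNorm a b z (z - x) ^ 2 - DikinWalk.localNorm a b x (z - x) ^ 2
          ≤ 2 * ε * (r ^ 2 / (n : ℝ))}
  set badP := {g | 361 * (n : ℝ) * L ^ 3 < (∑ i, inner ℝ (c i) g ^ 3) ^ 2}
  set badQ := {g | 8 * (n : ℝ) * L ^ 3 < ∑ i, inner ℝ (c i) g ^ 4}
  have hfm : Measurable f := by fun_prop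
  have hcover : Set.univ ⊆ f ⁻¹' G ∪ (badP ∪ badQ) := by
    intro g _
    by_cases h1 : g ∈ badP
    · exact Or.inr (Or.inl h1)
    by_cases h2 : g ∈ badQ
    · exact Or.inr (Or.inr h2)
    exact Or.inl (DikinWalk.mem_acceptance_of_cubic_quartic_le hn hx hε hε' hr hL hrL
      (not_lt.1 h1) (not_lt.1 h2))
  have h1 : 1 ≤ γ.real (f ⁻¹' G) + (γ.real badP + γ.real badQ) := by
    calc 1 = γ.real Set.univ := by simp
      _ ≤ γ.real (f ⁻¹' G ∪ (badP ∪ badQ)) := measureReal_mono hcover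
      _ ≤ γ.real (f ⁻¹' G) + γ.real (badP ∪ badQ) := measureReal_union_le _ _
      _ ≤ _ := by gcongr; exact measureReal_union_le _ _
  have h2 : γ.real (f ⁻¹' G) ≤ (DikinWalk.proposal a b r x).real G := by
    have : IsProbabilityMeasure (γ.map f) := Measure.isProbabilityMeasure_map hfm.aemeasurable
    rw [DikinWalk.proposal_eq_map]
    -- This inequality holds for any set, so measurability of `G` is never required.
    exact ENNReal.toReal_mono (measure_ne_top _ _) (Measure.le_map_apply hfm.aemeasurable G)
  linarith
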